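/- For $a,b\ge 0$, coefficients $\alpha,\beta\ge 0$ and $r\in[-\infty,\infty]$ let $M_r^{(\alpha,\beta)}(a,b)=0$ if $ab=0$, and, if $ab>0$, let $M_r^{(\alpha,\beta)}(a,b)$ be $(\alpha a^r+\beta b^r)^{1/r}$ if $r\ne 0,\pm\infty$, $a^\alpha b^\beta$ if $r=0$, $\max\{a,b\}$ if $r=+\infty$, and $\min\{a,b\}$ if $r=-\infty$. For $p\ge 1$, $1/p+1/q=1$ and $\lambda,t\in[0,1]$ put $$C_{p,\lambda,t}=(1-t)^{1/p}(1-\lambda)^{1/q},\qquad D_{p,\lambda,t}=t^{1/p}\lambda^{1/q}$$ (for $p=1$ we have $1/q=0$, and the factors $(1-\lambda)^{1/q}$ and $\lambda^{1/q}$ are $1$). Theorem ($L_p$-Borell–Brascamp–Lieb inequality for all $s\in(-\infty,\infty)$). Let $n\ge 1$, $p\ge 1$, $-\infty<s<\infty$ and $t\in(0,1)$, and let $f,g,h:\mathbb{R}^n\to[0,\infty)$ be bounded integrable functions such that $$h\left(C_{p,\lambda,t}x+D_{p,\lambda,t}y\right)\ \ge\ M_s^{(C_{p,\lambda,t},D_{p,\lambda,t})}(f(x),g(y))$$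 for all $x$ with $f(x)>0$, all $y$ with $g(y)>0$ and all $\lambda\in[0,1]$. Let $\gamma=\frac{s}{1+ns}$, with $\gamma=-\infty$ (and $p\gamma=-\infty$) if $s=-1/n$. Then: (i) if $s\ge-\frac1n$, then $$\int_{\mathbb{R}^n}h\ \ge\ M_{p\gamma}^{(1-t,t)}\left(\int_{\mathbb{R}^n}f,\int_{\mathbb{R}^n}g\right);$$ (ii) if $s<-\frac1n$, then for every $\lambda\in[0,1]$ $$\int_{\mathbb{R}^n}h\ \ge\ \min\left\{C_{p,\lambda,t}^{1/\gamma}\int_{\mathbb{R}^n}f,\ D_{p,\lambda,t}^{1/\gamma}\int_{\mathbb{R}^n}g\right\}.$$ -/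

import Mathlib

open MeasureTheory

noncomputable section

/-- The `L_p` coefficient `C_{p,λ,t} = (1 - t)^(1/p) (1 - λ)^(1/q)`, where `1/q = 1 - 1/p`
(for `p = 1` the second factor is `1`, since `0 ^ 0 = 1`). -/
def lpCoeffC (p lam t : ℝ) : ℝ := (1 - t) ^ (1 / p) * (1 - lam) ^ (1 - 1 / p)

/-- The `L_p` coefficient `D_{p,λ,t} = t^(1/p) λ^(1/q)`, where `1/q = 1 - 1/p`. -/
def lpCoeffD (p lam t : ℝ) : ℝ := t ^ (1 / p) * lam ^ (1 - 1 / p)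

open Classical in
/-- The `s`-mean `M_s^{(α,β)}(a,b)` of `a, b ≥ 0` with coefficients `α, β ≥ 0` (not necessarily
of sum `1`), for `s ∈ [-∞,∞]`; it is `0` unless `ab > 0`. -/
def sMean (s : EReal) (α β a b : ℝ) : ℝ :=
  if 0 < a * b then
    if s = ⊥ then min a b
    else if s = ⊤ then max a b
    else if s = 0 then a ^ α * b ^ β
    else (α * a ^ s.toReal + β * b ^ s.toReal) ^ (1 / s.toReal)
  else 0

open Classical in
/-- The exponent `γ = s / (1 + n s)` for `s ≥ -1/n`, read as `-∞` at `s = -1/n`. -/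
def bblExponent (n : ℕ) (s : ℝ) : EReal :=
  if 1 + (n : ℝ) * s = 0 then ⊥ else ((s / (1 + (n : ℝ) * s) : ℝ) : EReal)

end

/-!
Every exponent is reduced to `s = -1/n`, where the conclusion is `min (∫ f) (∫ g) ≤ ∫ h` whatever
the coefficients `C` and `D`, since these can be absorbed by rescaling `f` and `g`. There the
inequality is proved by induction on the dimension. On the line, one-dimensional Brunn–Minkowski
applied to the superlevel sets of functions of supremum `1` bounds `∫ f + ∫ g`, and Radon's
inequality turns this into a bound for a power sum of exponent `-1/κ` when the hypothesis has
exponent `-1/(κ + 1)`. Integrating out the variables one at a time thus brings `κ` from `n` down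
to `0`, where the power sum is the minimum.

For `s > -1/n`, divide `f` and `g` by their integrals and `h` by the `γ`-mean of these; Hölder's
inequality for `s`-means shows that the quotients satisfy the hypothesis with exponent `-1/n`. For
`s < -1/n`, subadditivity of `x ↦ x ^ θ` with `θ = -1/(n s)` does the same for suitable multiples
of `f` and `g`. Finally, the mean of exponent `p γ` with weights `1 - t` and `t` is the supremum (or
infimum, according to the sign of `γ`) over `λ` of the `γ`-means with the `L_p` coefficients,
attained in the equality case of Hölder's inequality; this is the `λ` to use.
-/

open Set Filter Topology Module Function
open scoped ENNReal NNReal Pointwise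

theorem volume_add_volume_le_of_isCompact {K L : Set ℝ} (hK : IsCompact K) (hL : IsCompact L)
    (hK₀ : K.Nonempty) (hL₀ : L.Nonempty) : volume K + volume L ≤ volume (K + L) := by
  obtain ⟨a, haK, ha⟩ := hK.exists_isGreatest hK₀
  obtain ⟨b, hbL, hb⟩ := hL.exists_isLeast hL₀
  -- The translates `b +ᵥ K` and `a +ᵥ L` lie in `K + L` and meet only at `a + b`.
  have hsub : (b +ᵥ K) ∪ (a +ᵥ L) ⊆ K + L := by
    rintro _ (⟨x, hx, rfl⟩ | ⟨y, hy, rfl⟩)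
    · simpa only [vadd_eq_add, add_comm b x] using add_mem_add hx hbL
    · exact add_mem_add haK hy
  have hdisj : AEDisjoint volume (b +ᵥ K) (a +ᵥ L) := by
    refine measure_mono_null (t := {a + b}) ?_ (by simp)
    rintro _ ⟨⟨x, hx, rfl⟩, ⟨y, hy, hxy⟩⟩
    have hxa : x ≤ a := ha hx
    have hby : b ≤ y := hb hy
    simp only [vadd_eq_add, mem_singleton_iff] at hxy ⊢
    linarith
  calc volume K + volume L = volume ((b +ᵥ K) ∪ (a +ᵥ L)) := by
        rw [measure_union₀ (hL.vadd a).measurableSet.nullMeasurableSet hdisj, measure_vadd,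
          measure_vadd]
    _ ≤ volume (K + L) := measure_mono hsub

theorem volume_add_volume_le_volume_add {X Y : Set ℝ} (hX : MeasurableSet X)
    (hY : MeasurableSet Y) (hX₀ : X.Nonempty) (hY₀ : Y.Nonempty) :
    volume X + volume Y ≤ volume (X + Y) := by
  obtain ⟨x, hx⟩ := hX₀
  obtain ⟨y, hy⟩ := hY₀
  rw [hX.measure_eq_iSup_isCompact, hY.measure_eq_iSup_isCompact]
  simp_rw [iSup_and']
  refine ENNReal.biSup_add_biSup_le' ⟨∅, empty_subset X, isCompact_empty⟩
    ⟨∅, empty_subset Y, isCompact_empty⟩ fun K ⟨hKX, hK⟩ L ⟨hLY, hL⟩ => ?_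
  calc volume K + volume L ≤ volume (insert x K) + volume (insert y L) := by
        gcongr <;> exact subset_insert _ _
    _ ≤ volume (insert x K + insert y L) :=
        volume_add_volume_le_of_isCompact (hK.insert x) (hL.insert y) (insert_nonempty x K)
          (insert_nonempty y L)
    _ ≤ volume (X + Y) :=
        measure_mono (add_subset_add (insert_subset hx hKX) (insert_subset hy hLY))

section LayerCake

variable {α : Type*} [MeasurableSpace α]

theorem lintegral_min_ofReal_eq_setLIntegral_meas_lt (μ : Measure α) {u : α → ℝ≥0∞}
    (hu : AEMeasurable u μ) (c : ℝ) :
    ∫⁻ x, min (u x) (ENNReal.ofReal c) ∂μ =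
      ∫⁻ t in Ioo 0 c, μ {x | ENNReal.ofReal t < u x} := by
  have hfin : ∀ x, min (u x) (ENNReal.ofReal c) ≠ ∞ := fun x =>
    ne_top_of_le_ne_top ENNReal.ofReal_ne_top (min_le_right _ _)
  have hlevel : ∀ t ∈ Ioi (0 : ℝ), μ {x | t < (min (u x) (ENNReal.ofReal c)).toReal} =
      (Ioo 0 c).indicator (fun t => μ {x | ENNReal.ofReal t < u x}) t := by
    intro t ht
    simp_rw [← fun x => ENNReal.ofReal_lt_iff_lt_toReal (le_of_lt ht) (hfin x), lt_min_iff,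
      ENNReal.ofReal_lt_ofReal_iff_of_nonneg (le_of_lt ht)]
    by_cases htc : t < c
    · rw [indicator_of_mem (show t ∈ Ioo 0 c from ⟨ht, htc⟩)]
      simp only [htc, and_true]
    · rw [indicator_of_notMem fun h : t ∈ Ioo 0 c => htc h.2]
      simp only [htc, and_false, ofPred_false, measure_empty]
  calc ∫⁻ x, min (u x) (ENNReal.ofReal c) ∂μ
      = ∫⁻ x, ENNReal.ofReal (min (u x) (ENNReal.ofReal c)).toReal ∂μ := by
        simp_rw [ENNReal.ofReal_toReal (hfin _)]
    _ = ∫⁻ t in Ioi 0, μ {x | t < (min (u x) (ENNReal.ofReal c)).toReal} :=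
        lintegral_eq_lintegral_meas_lt μ (.of_forall fun _ => ENNReal.toReal_nonneg)
          (hu.min aemeasurable_const).ennreal_toReal
    _ = ∫⁻ t in Ioo 0 c, μ {x | ENNReal.ofReal t < u x} := by
        rw [setLIntegral_congr_fun measurableSet_Ioi hlevel,
          setLIntegral_indicator measurableSet_Ioo, inter_eq_left.2 Ioo_subset_Ioi_self]

theorem tendsto_lintegral_min_natCast {μ : Measure α} {u : α → ℝ≥0∞} (hu : AEMeasurable u μ) :
    Tendsto (fun N : ℕ => ∫⁻ x, min (u x) N ∂μ) atTop (𝓝 (∫⁻ x, u x ∂μ)) := by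
  refine lintegral_tendsto_of_tendsto_of_monotone (fun N => hu.min aemeasurable_const)
    (.of_forall fun x M N hMN => min_le_min le_rfl (Nat.cast_le.2 hMN)) (.of_forall fun x => ?_)
  simpa using tendsto_const_nhds.min ENNReal.tendsto_nat_nhds_top

theorem exists_measurable_ge_lintegral_eq {μ : Measure α} {u : α → ℝ≥0∞}
    (hu : AEMeasurable u μ) : ∃ v, Measurable v ∧ u ≤ v ∧ ∫⁻ x, v x ∂μ = ∫⁻ x, u x ∂μ := by
  set N := toMeasurable μ {x | u x ≠ hu.mk u x}
  have hN : μ N = 0 := (measure_toMeasurable _).trans hu.ae_eq_mk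
  have hN_meas : MeasurableSet N := measurableSet_toMeasurable _ _
  refine ⟨fun x => hu.mk u x + N.indicator (fun _ => ∞) x,
    hu.measurable_mk.add (measurable_const.indicator hN_meas), fun x => ?_, ?_⟩
  · by_cases hx : x ∈ N
    · simp [hx]
    · have hux : u x = hu.mk u x := by
        by_contra h
        exact hx (subset_toMeasurable _ _ h)
      exact hux.le.trans le_self_add
  · rw [lintegral_add_left hu.measurable_mk, lintegral_indicator hN_meas,
      setLIntegral_measure_zero _ _ hN, add_zero]
    exact lintegral_congr_ae hu.ae_eq_mk.symm

end LayerCake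

theorem lintegral_add_lintegral_le_of_iSup_eq_one {f g h : ℝ → ℝ≥0∞} (hf : Measurable f)
    (hg : Measurable g) (hh : Measurable h) (hf₁ : ⨆ x, f x = 1) (hg₁ : ⨆ x, g x = 1)
    (hfgh : ∀ x y, min (f x) (g y) ≤ h (x + y)) :
    (∫⁻ x, f x) + (∫⁻ x, g x) ≤ ∫⁻ x, h x := by
  have layer : ∀ {u : ℝ → ℝ≥0∞}, Measurable u →
      ∫⁻ x, min (u x) 1 = ∫⁻ t in Ioo (0 : ℝ) 1, volume {x | ENNReal.ofReal t < u x} := by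
    intro u hu
    simpa only [ENNReal.ofReal_one] using
      lintegral_min_ofReal_eq_setLIntegral_meas_lt volume hu.aemeasurable 1
  have layer_of_iSup : ∀ {u : ℝ → ℝ≥0∞}, Measurable u → ⨆ x, u x = 1 →
      ∫⁻ x, u x = ∫⁻ t in Ioo (0 : ℝ) 1, volume {x | ENNReal.ofReal t < u x} := by
    intro u hu hu₁
    rw [← layer hu]
    exact lintegral_congr fun x => (min_eq_left (hu₁ ▸ le_iSup u x)).symm
  have superlevel_measurable : Measurable fun t : ℝ => volume {x | ENNReal.ofReal t < f x} :=
    Antitone.measurable fun s t hst =>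
      measure_mono fun x hx => (ENNReal.ofReal_le_ofReal hst).trans_lt hx
  calc (∫⁻ x, f x) + (∫⁻ x, g x)
      = ∫⁻ t in Ioo (0 : ℝ) 1, volume {x | ENNReal.ofReal t < f x} +
          volume {x | ENNReal.ofReal t < g x} := by
        rw [layer_of_iSup hf hf₁, layer_of_iSup hg hg₁, lintegral_add_left superlevel_measurable]
    _ ≤ ∫⁻ t in Ioo (0 : ℝ) 1, volume {x | ENNReal.ofReal t < h x} := by
        refine setLIntegral_mono' measurableSet_Ioo fun t ht => ?_
        have ht₁ : ENNReal.ofReal t < 1 := ENNReal.ofReal_lt_one.2 ht.2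
        have superlevel_nonempty : ∀ {u : ℝ → ℝ≥0∞}, ⨆ x, u x = 1 →
            {x | ENNReal.ofReal t < u x}.Nonempty := fun hu₁ =>
          let ⟨x, hx⟩ := lt_iSup_iff.1 (hu₁ ▸ ht₁)
          ⟨x, hx⟩
        refine (volume_add_volume_le_volume_add (measurableSet_lt measurable_const hf)
          (measurableSet_lt measurable_const hg) (superlevel_nonempty hf₁)
          (superlevel_nonempty hg₁)).trans (measure_mono ?_)
        rintro _ ⟨x, hx, y, hy, rfl⟩
        exact (lt_min hx hy).trans_le (hfgh x y)
    _ = ∫⁻ x, min (h x) 1 := (layer hh).symm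
    _ ≤ ∫⁻ x, h x := lintegral_mono fun x => min_le_left _ _

theorem rpow_mul_rpow_add_le {θ x y u v : ℝ} (hθ₀ : 0 ≤ θ) (hθ₁ : θ ≤ 1) (hx : 0 < x)
    (hy : 0 < y) (hu : 0 < u) (hv : 0 < v) :
    x ^ θ * u ^ (1 - θ) + y ^ θ * v ^ (1 - θ) ≤ (x + y) ^ θ * (u + v) ^ (1 - θ) := by
  have amgm : ∀ {a b : ℝ}, 0 < a → 0 < b → a ^ θ * b ^ (1 - θ) ≤
      (θ * (a / (x + y)) + (1 - θ) * (b / (u + v))) * ((x + y) ^ θ * (u + v) ^ (1 - θ)) := by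
    intro a b ha hb
    rw [← div_le_iff₀ (by positivity), mul_div_mul_comm, ← Real.div_rpow ha.le (by positivity),
      ← Real.div_rpow hb.le (by positivity)]
    exact Real.geom_mean_le_arith_mean2_weighted hθ₀ (sub_nonneg.2 hθ₁) (by positivity)
      (by positivity) (add_sub_cancel θ 1)
  calc x ^ θ * u ^ (1 - θ) + y ^ θ * v ^ (1 - θ)
      ≤ _ := add_le_add (amgm hx hu) (amgm hy hv)
    _ = (x + y) ^ θ * (u + v) ^ (1 - θ) := by field_simp; ring

theorem add_rpow_mul_add_rpow_neg_le {κ u v x y : ℝ} (hκ : 0 ≤ κ) (hu : 0 < u) (hv : 0 < v)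
    (hx : 0 < x) (hy : 0 < y) :
    (u + v) ^ (κ + 1) * (x + y) ^ (-κ) ≤ u ^ (κ + 1) * x ^ (-κ) + v ^ (κ + 1) * y ^ (-κ) := by
  set θ := (κ + 1)⁻¹ with hθ
  set S := u ^ (κ + 1) * x ^ (-κ) + v ^ (κ + 1) * y ^ (-κ)
  have hκ₁ : 0 < κ + 1 := by positivity
  have hθκ : (1 - θ) * (κ + 1) = κ := by rw [hθ]; field_simp; ring
  have split : ∀ {a b : ℝ}, 0 < a → 0 < b → (a ^ (κ + 1) * b ^ (-κ)) ^ θ * b ^ (1 - θ) = a := by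
    intro a b ha hb
    rw [Real.mul_rpow (by positivity) (by positivity), ← Real.rpow_mul ha.le,
      ← Real.rpow_mul hb.le, mul_assoc, ← Real.rpow_add hb, hθ, mul_inv_cancel₀ hκ₁.ne',
      Real.rpow_one, show -κ * (κ + 1)⁻¹ + (1 - (κ + 1)⁻¹) = 0 by field_simp; ring,
      Real.rpow_zero, mul_one]
  have holder : u + v ≤ S ^ θ * (x + y) ^ (1 - θ) := by
    have := rpow_mul_rpow_add_le (by positivity : 0 ≤ θ) (inv_le_one_of_one_le₀ (by linarith))
      (x := u ^ (κ + 1) * x ^ (-κ)) (y := v ^ (κ + 1) * y ^ (-κ)) (by positivity)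
      (by positivity) hx hy
    rwa [split hu hx, split hv hy] at this
  rw [Real.rpow_neg (by positivity), ← div_eq_mul_inv, div_le_iff₀ (by positivity)]
  calc (u + v) ^ (κ + 1) ≤ (S ^ θ * (x + y) ^ (1 - θ)) ^ (κ + 1) :=
        Real.rpow_le_rpow (by positivity) holder hκ₁.le
    _ = S * (x + y) ^ κ := by
        rw [Real.mul_rpow (by positivity) (by positivity), ← Real.rpow_mul (by positivity),
          ← Real.rpow_mul (by positivity), hθκ, inv_mul_cancel₀ hκ₁.ne', Real.rpow_one]

/-- The unnormalised power mean `(a ^ (-1/κ) + b ^ (-1/κ)) ^ (-κ)` of negative exponent `-1/κ`,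
extended to `κ = 0` by its limit `min a b`. It is parametrised by `κ` rather than by the exponent
because integrating out one variable lowers `κ` by one. -/
noncomputable def negPowerSum (κ : ℝ) (a b : ℝ≥0∞) : ℝ≥0∞ :=
  if κ = 0 then min a b else (a ^ (-κ⁻¹) + b ^ (-κ⁻¹)) ^ (-κ)

section negPowerSum

theorem negPowerSum_zero (a b : ℝ≥0∞) : negPowerSum 0 a b = min a b := if_pos rfl

variable {κ : ℝ}

theorem negPowerSum_of_ne_zero (hκ : κ ≠ 0) (a b : ℝ≥0∞) :
    negPowerSum κ a b = (a ^ (-κ⁻¹) + b ^ (-κ⁻¹)) ^ (-κ) := if_neg hκ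

theorem negPowerSum_mono (hκ : 0 ≤ κ) {a a' b b' : ℝ≥0∞} (ha : a ≤ a') (hb : b ≤ b') :
    negPowerSum κ a b ≤ negPowerSum κ a' b' := by
  unfold negPowerSum
  split_ifs
  · exact min_le_min ha hb
  · simp only [ENNReal.rpow_neg]
    gcongr

theorem negPowerSum_zero_left (hκ : 0 ≤ κ) (b : ℝ≥0∞) : negPowerSum κ 0 b = 0 := by
  rcases hκ.eq_or_lt with rfl | hκ
  · rw [negPowerSum_zero, zero_min]
  · rw [negPowerSum_of_ne_zero hκ.ne', ENNReal.zero_rpow_of_neg (by simpa using hκ), top_add,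
      ENNReal.top_rpow_of_neg (by simpa using hκ)]

theorem negPowerSum_comm (a b : ℝ≥0∞) : negPowerSum κ a b = negPowerSum κ b a := by
  simp only [negPowerSum, min_comm, add_comm]

theorem negPowerSum_zero_right (hκ : 0 ≤ κ) (a : ℝ≥0∞) : negPowerSum κ a 0 = 0 := by
  rw [negPowerSum_comm, negPowerSum_zero_left hκ]

theorem tendsto_negPowerSum {ι : Type*} {l : Filter ι} {u v : ι → ℝ≥0∞} {a b : ℝ≥0∞}
    (hu : Tendsto u l (𝓝 a)) (hv : Tendsto v l (𝓝 b)) :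
    Tendsto (fun i => negPowerSum κ (u i) (v i)) l (𝓝 (negPowerSum κ a b)) := by
  unfold negPowerSum
  split_ifs
  · exact hu.min hv
  · exact ((hu.ennrpow_const _).add (hv.ennrpow_const _)).ennrpow_const _

theorem negPowerSum_mul_right (hκ : 0 ≤ κ) (a b : ℝ≥0∞) {c : ℝ≥0∞} (hc : c ≠ ∞) :
    negPowerSum κ (a * c) (b * c) = negPowerSum κ a b * c := by
  rcases eq_or_ne c 0 with rfl | hc₀
  · simp only [mul_zero, negPowerSum_zero_left hκ]
  rcases hκ.eq_or_lt with rfl | hκ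
  · simp only [negPowerSum_zero, min_mul_of_nonneg _ _ (zero_le (a := c))]
  have mul_rpow : ∀ (x : ℝ≥0∞) {y : ℝ≥0∞} (r : ℝ), y ≠ 0 → y ≠ ∞ →
      (x * y) ^ r = x ^ r * y ^ r := fun x y r hy₀ hy => by
    simp [ENNReal.mul_rpow_eq_ite, hy₀, hy]
  rw [negPowerSum_of_ne_zero hκ.ne', negPowerSum_of_ne_zero hκ.ne', mul_rpow _ _ hc₀ hc,
    mul_rpow _ _ hc₀ hc, ← add_mul, mul_rpow _ _ (by simp [ENNReal.rpow_eq_zero_iff, hc₀, hc])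
    (by simp [ENNReal.rpow_eq_top_iff, hc₀, hc]), ← ENNReal.rpow_mul, neg_mul_neg,
    inv_mul_cancel₀ hκ.ne', ENNReal.rpow_one]

theorem min_mul_negPowerSum_le (hκ : 0 ≤ κ) (a b : ℝ≥0∞) {u v : ℝ≥0∞} (hu : u ≠ ∞) :
    min u v * negPowerSum κ a b ≤ negPowerSum κ (a * u) (b * v) := by
  rw [mul_comm, ← negPowerSum_mul_right hκ _ _ (ne_top_of_le_ne_top hu (min_le_left u v))]
  exact negPowerSum_mono hκ (by gcongr; exact min_le_left _ _) (by gcongr; exact min_le_right _ _)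

theorem negPowerSum_ne_zero_ne_top (hκ : 0 < κ) {a b : ℝ≥0∞} (ha₀ : a ≠ 0) (ha : a ≠ ∞)
    (hb₀ : b ≠ 0) (hb : b ≠ ∞) : negPowerSum κ a b ≠ 0 ∧ negPowerSum κ a b ≠ ∞ := by
  rw [negPowerSum_of_ne_zero hκ.ne']
  constructor <;> simp [ENNReal.rpow_eq_zero_iff, ENNReal.rpow_eq_top_iff, *]

theorem negPowerSum_ofReal (hκ : 0 < κ) {a b : ℝ} (ha : 0 < a) (hb : 0 < b) :
    negPowerSum κ (ENNReal.ofReal a) (ENNReal.ofReal b) =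
      ENNReal.ofReal ((a ^ (-κ⁻¹) + b ^ (-κ⁻¹)) ^ (-κ)) := by
  rw [negPowerSum_of_ne_zero hκ.ne', ENNReal.ofReal_rpow_of_pos ha, ENNReal.ofReal_rpow_of_pos hb,
    ← ENNReal.ofReal_add (by positivity) (by positivity),
    ENNReal.ofReal_rpow_of_pos (by positivity)]

theorem rpow_neg_inv_add_rpow_neg_inv_rpow_neg_le (hκ : 0 < κ) {u v a b : ℝ} (hu : 0 < u)
    (hv : 0 < v) (huv : u + v = 1) (ha : 0 < a) (hb : 0 < b) :
    (a ^ (-κ⁻¹) + b ^ (-κ⁻¹)) ^ (-κ) ≤ u ^ (κ + 1) * a + v ^ (κ + 1) * b := by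
  have rpow_rpow : ∀ {x : ℝ}, 0 < x → (x ^ (-κ⁻¹)) ^ (-κ) = x := fun hx => by
    rw [← Real.rpow_mul hx.le, neg_mul_neg, inv_mul_cancel₀ hκ.ne', Real.rpow_one]
  have radon := add_rpow_mul_add_rpow_neg_le hκ.le hu hv (x := a ^ (-κ⁻¹)) (y := b ^ (-κ⁻¹))
    (by positivity) (by positivity)
  rwa [huv, Real.one_rpow, one_mul, rpow_rpow ha, rpow_rpow hb] at radon

/-- Radon's inequality in dual form: `negPowerSum κ a b` is the infimum of these sums over the
weights `u` and `v`. -/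
theorem negPowerSum_le_rpow_mul_add_rpow_mul (hκ : 0 ≤ κ) {u v : ℝ≥0∞} (hu : u ≠ 0) (hv : v ≠ 0)
    (huv : u + v = 1) (a b : ℝ≥0∞) :
    negPowerSum κ a b ≤ u ^ (κ + 1) * a + v ^ (κ + 1) * b := by
  rcases hκ.eq_or_lt with rfl | hκ
  · rw [negPowerSum_zero, zero_add, ENNReal.rpow_one, ENNReal.rpow_one]
    calc min a b = u * min a b + v * min a b := by rw [← add_mul, huv, one_mul]
      _ ≤ u * a + v * b := by gcongr; exacts [min_le_left a b, min_le_right a b]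
  have weight_ne_zero : ∀ {w : ℝ≥0∞}, w ≠ 0 → w ^ (κ + 1) ≠ 0 := fun hw => by
    simp [ENNReal.rpow_eq_zero_iff, hw, hκ.le, add_nonneg, not_lt]
  rcases eq_or_ne a 0 with rfl | ha₀
  · simp [negPowerSum_zero_left hκ.le]
  rcases eq_or_ne b 0 with rfl | hb₀
  · simp [negPowerSum_zero_right hκ.le]
  rcases eq_or_ne a ∞ with rfl | ha
  · simp [ENNReal.mul_top (weight_ne_zero hu)]
  rcases eq_or_ne b ∞ with rfl | hb
  · simp [ENNReal.mul_top (weight_ne_zero hv)]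
  lift u to ℝ≥0 using ne_top_of_le_ne_top ENNReal.one_ne_top (huv ▸ le_self_add)
  lift v to ℝ≥0 using ne_top_of_le_ne_top ENNReal.one_ne_top (huv ▸ le_add_self)
  lift a to ℝ≥0 using ha
  lift b to ℝ≥0 using hb
  rw [ENNReal.coe_ne_zero, ← pos_iff_ne_zero, ← NNReal.coe_pos] at hu hv ha₀ hb₀
  simp only [← ENNReal.ofReal_coe_nnreal]
  rw [negPowerSum_ofReal hκ ha₀ hb₀, ENNReal.ofReal_rpow_of_pos hu, ENNReal.ofReal_rpow_of_pos hv,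
    ← ENNReal.ofReal_mul (by positivity), ← ENNReal.ofReal_mul (by positivity),
    ← ENNReal.ofReal_add (by positivity) (by positivity)]
  exact ENNReal.ofReal_le_ofReal
    (rpow_neg_inv_add_rpow_neg_inv_rpow_neg_le hκ hu hv (by exact_mod_cast huv) ha₀ hb₀)

theorem negPowerSum_le_negPowerSum_add_one_mul (hκ : 0 ≤ κ) {A B : ℝ≥0∞} (hA₀ : A ≠ 0)
    (hA : A ≠ ∞) (hB₀ : B ≠ 0) (hB : B ≠ ∞) (a b : ℝ≥0∞) :
    negPowerSum κ a b ≤ negPowerSum (κ + 1) A B * (a / A + b / B) := by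
  have hκ₁ : 0 < κ + 1 := by positivity
  set x := A ^ (-(κ + 1)⁻¹)
  set y := B ^ (-(κ + 1)⁻¹)
  have ne_zero_ne_top : ∀ {C : ℝ≥0∞}, C ≠ 0 → C ≠ ∞ →
      C ^ (-(κ + 1)⁻¹) ≠ 0 ∧ C ^ (-(κ + 1)⁻¹) ≠ ∞ := fun h₀ h => by
    constructor <;> simp [ENNReal.rpow_eq_zero_iff, ENNReal.rpow_eq_top_iff, *]
  obtain ⟨hx₀, hx_top⟩ := ne_zero_ne_top hA₀ hA
  obtain ⟨hy₀, hy_top⟩ := ne_zero_ne_top hB₀ hB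
  have hxy_top : x + y ≠ ∞ := ENNReal.add_ne_top.2 ⟨hx_top, hy_top⟩
  have weight : ∀ C c : ℝ≥0∞, (C ^ (-(κ + 1)⁻¹) / (x + y)) ^ (κ + 1) * c =
      negPowerSum (κ + 1) A B * (c / C) := fun C c => by
    rw [negPowerSum_of_ne_zero hκ₁.ne', ENNReal.div_rpow_of_nonneg _ _ hκ₁.le, ← ENNReal.rpow_mul,
      neg_mul, inv_mul_cancel₀ hκ₁.ne', ENNReal.rpow_neg_one, ENNReal.rpow_neg, div_eq_mul_inv,
      div_eq_mul_inv, mul_comm C⁻¹, mul_assoc, mul_comm C⁻¹]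
  rw [mul_add, ← weight, ← weight]
  refine negPowerSum_le_rpow_mul_add_rpow_mul hκ (ENNReal.div_ne_zero.2 ⟨hx₀, hxy_top⟩)
    (ENNReal.div_ne_zero.2 ⟨hy₀, hxy_top⟩) ?_ a b
  rw [ENNReal.div_add_div_same, ENNReal.div_self (fun h => hx₀ (add_eq_zero.1 h).1) hxy_top]

end negPowerSum

section BorellBrascampLieb

variable {κ : ℝ}

theorem negPowerSum_iSup_mul_lintegral_le (hκ : 0 < κ) {f g h : ℝ → ℝ≥0∞} (hf : Measurable f)
    (hg : Measurable g) (hh : Measurable h) (hA₀ : ⨆ x, f x ≠ 0) (hA : ⨆ x, f x ≠ ∞)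
    (hB₀ : ⨆ x, g x ≠ 0) (hB : ⨆ x, g x ≠ ∞)
    (hfgh : ∀ x y, negPowerSum κ (f x) (g y) ≤ h (x + y)) :
    negPowerSum κ (⨆ x, f x) (⨆ x, g x) *
      ((∫⁻ x, f x) / (⨆ x, f x) + (∫⁻ x, g x) / (⨆ x, g x)) ≤ ∫⁻ x, h x := by
  set A := ⨆ x, f x with hA_def
  set B := ⨆ x, g x with hB_def
  set c := negPowerSum κ A B
  obtain ⟨hc₀, hc⟩ : c ≠ 0 ∧ c ≠ ∞ := negPowerSum_ne_zero_ne_top hκ hA₀ hA hB₀ hB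
  have normalized : (∫⁻ x, f x / A) + (∫⁻ x, g x / B) ≤ ∫⁻ x, h x / c := by
    refine lintegral_add_lintegral_le_of_iSup_eq_one (hf.div_const _) (hg.div_const _)
      (hh.div_const _) ?_ ?_ fun x y => ?_
    · rw [← ENNReal.iSup_div, ← hA_def, ENNReal.div_self hA₀ hA]
    · rw [← ENNReal.iSup_div, ← hB_def, ENNReal.div_self hB₀ hB]
    · rw [ENNReal.le_div_iff_mul_le (.inl hc₀) (.inl hc)]
      have hfA : f x / A ≠ ∞ :=
        ENNReal.div_ne_top (ne_top_of_le_ne_top hA (le_iSup f x)) hA₀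
      calc min (f x / A) (g y / B) * c ≤ negPowerSum κ (A * (f x / A)) (B * (g y / B)) :=
            min_mul_negPowerSum_le hκ.le A B hfA
        _ ≤ h (x + y) := by
            rw [ENNReal.mul_div_cancel hA₀ hA, ENNReal.mul_div_cancel hB₀ hB]
            exact hfgh x y
  simp_rw [div_eq_mul_inv] at normalized ⊢
  rw [lintegral_mul_const _ hf, lintegral_mul_const _ hg, lintegral_mul_const _ hh] at normalized
  calc c * ((∫⁻ x, f x) * A⁻¹ + (∫⁻ x, g x) * B⁻¹) ≤ c * ((∫⁻ x, h x) * c⁻¹) := by gcongr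
    _ = ∫⁻ x, h x := ENNReal.mul_div_cancel hc₀ hc

theorem negPowerSum_lintegral_le_of_iSup_ne_top (hκ : 0 ≤ κ) {f g h : ℝ → ℝ≥0∞}
    (hf : Measurable f) (hg : Measurable g) (hh : Measurable h) (hA : ⨆ x, f x ≠ ∞)
    (hB : ⨆ x, g x ≠ ∞) (hfgh : ∀ x y, negPowerSum (κ + 1) (f x) (g y) ≤ h (x + y)) :
    negPowerSum κ (∫⁻ x, f x) (∫⁻ x, g x) ≤ ∫⁻ x, h x := by
  rcases eq_or_ne (⨆ x, f x) 0 with hA₀ | hA₀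
  · simp only [ENNReal.iSup_eq_zero.1 hA₀, lintegral_zero, negPowerSum_zero_left hκ, zero_le]
  rcases eq_or_ne (⨆ x, g x) 0 with hB₀ | hB₀
  · simp only [ENNReal.iSup_eq_zero.1 hB₀, lintegral_zero, negPowerSum_zero_right hκ, zero_le]
  exact (negPowerSum_le_negPowerSum_add_one_mul hκ hA₀ hA hB₀ hB _ _).trans
    (negPowerSum_iSup_mul_lintegral_le (by positivity) hf hg hh hA₀ hA hB₀ hB hfgh)

theorem negPowerSum_lintegral_le_real (hκ : 0 ≤ κ) {f g h : ℝ → ℝ≥0∞} (hf : Measurable f)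
    (hg : Measurable g) (hh : Measurable h)
    (hfgh : ∀ x y, negPowerSum (κ + 1) (f x) (g y) ≤ h (x + y)) :
    negPowerSum κ (∫⁻ x, f x) (∫⁻ x, g x) ≤ ∫⁻ x, h x := by
  have iSup_min_ne_top : ∀ (u : ℝ → ℝ≥0∞) (N : ℕ), ⨆ x, min (u x) N ≠ ∞ := fun u N =>
    ne_top_of_le_ne_top (ENNReal.natCast_ne_top N) (iSup_le fun x => min_le_right (u x) N)
  refine le_of_tendsto (tendsto_negPowerSum (tendsto_lintegral_min_natCast hf.aemeasurable)
    (tendsto_lintegral_min_natCast hg.aemeasurable)) (.of_forall fun N => ?_)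
  exact negPowerSum_lintegral_le_of_iSup_ne_top hκ (hf.min measurable_const)
    (hg.min measurable_const) hh (iSup_min_ne_top f N) (iSup_min_ne_top g N) fun x y =>
      (negPowerSum_mono (by positivity) (min_le_left _ _) (min_le_left _ _)).trans (hfgh x y)

theorem negPowerSum_lintegral_le_pi (n : ℕ) (hκ : 0 ≤ κ) {f g h : (Fin n → ℝ) → ℝ≥0∞}
    (hf : Measurable f) (hg : Measurable g) (hh : Measurable h)
    (hfgh : ∀ x y, negPowerSum (n + κ) (f x) (g y) ≤ h (x + y)) :
    negPowerSum κ (∫⁻ x, f x) (∫⁻ x, g x) ≤ ∫⁻ x, h x := by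
  induction n generalizing κ with
  | zero =>
    have lintegral_eq : ∀ u : (Fin 0 → ℝ) → ℝ≥0∞, ∫⁻ x, u x = u 0 := fun u => by
      rw [volume_pi, Measure.pi_of_empty _ 0, lintegral_dirac]
    simpa only [lintegral_eq, Nat.cast_zero, zero_add] using hfgh 0 0
  | succ n ih =>
    let e := (MeasurableEquiv.piFinSuccAbove (fun _ : Fin (n + 1) => ℝ) 0).symm
    have he : MeasurePreserving e :=
      (volume_preserving_piFinSuccAbove (fun _ : Fin (n + 1) => ℝ) 0).symm _
    have e_add : ∀ a b : ℝ × (Fin n → ℝ), e (a + b) = e a + e b := fun a b => by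
      ext i
      cases i using Fin.cases <;> simp [e, MeasurableEquiv.piFinSuccAbove]
    have fubini : ∀ {u : (Fin (n + 1) → ℝ) → ℝ≥0∞}, Measurable u →
        ∫⁻ x, u x = ∫⁻ a, ∫⁻ b, u (e (a, b)) := fun {u} hu => by
      rw [← he.lintegral_comp hu, Measure.volume_eq_prod,
        lintegral_prod (fun z => u (e z)) (hu.comp e.measurable).aemeasurable]
    have measurable_slice : ∀ {u : (Fin (n + 1) → ℝ) → ℝ≥0∞}, Measurable u → ∀ a,
        Measurable fun b => u (e (a, b)) := fun hu a =>
      hu.comp (e.measurable.comp measurable_prodMk_left)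
    have measurable_slice_lintegral : ∀ {u : (Fin (n + 1) → ℝ) → ℝ≥0∞}, Measurable u →
        Measurable fun a => ∫⁻ b, u (e (a, b)) := fun hu =>
      (hu.comp e.measurable).lintegral_prod_right'
    rw [fubini hf, fubini hg, fubini hh]
    refine negPowerSum_lintegral_le_real hκ (measurable_slice_lintegral hf)
      (measurable_slice_lintegral hg) (measurable_slice_lintegral hh) fun a a' => ?_
    refine ih (by positivity) (measurable_slice hf a) (measurable_slice hg a')
      (measurable_slice hh (a + a')) fun b b' => ?_
    rw [← Prod.mk_add_mk, e_add, show (n : ℝ) + (κ + 1) = (n + 1 : ℕ) + κ by push_cast; ring]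
    exact hfgh _ _

section FiniteDimensional

variable {E : Type*} [NormedAddCommGroup E] [NormedSpace ℝ E] [FiniteDimensional ℝ E]
  [MeasurableSpace E] [BorelSpace E] (μ : Measure E) [μ.IsAddHaarMeasure]

theorem exists_lintegral_eq_mul_lintegral_pi :
    ∃ (e : (Fin (finrank ℝ E) → ℝ) ≃L[ℝ] E) (c : ℝ≥0∞), c ≠ ∞ ∧
      ∀ u : E → ℝ≥0∞, Measurable u → ∫⁻ x, u x ∂μ = (∫⁻ y, u (e y)) * c := by
  let φ : E ≃L[ℝ] (Fin (finrank ℝ E) → ℝ) := (finBasis ℝ E).equivFunL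
  have : (μ.map φ).IsAddHaarMeasure := φ.isAddHaarMeasure_map μ
  obtain ⟨c, map_eq⟩ : ∃ c : ℝ≥0, μ.map φ = c • volume :=
    ⟨_, Measure.isAddLeftInvariant_eq_smul _ _⟩
  refine ⟨φ.symm, c, ENNReal.coe_ne_top, fun u hu => ?_⟩
  have hu_symm : Measurable fun y => u (φ.symm y) := hu.comp φ.symm.continuous.measurable
  calc ∫⁻ x, u x ∂μ = ∫⁻ y, u (φ.symm y) ∂(μ.map φ) := by
        simp only [lintegral_map hu_symm φ.continuous.measurable,
          ContinuousLinearEquiv.symm_apply_apply]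
    _ = (∫⁻ y, u (φ.symm y)) * c := by
        rw [map_eq, lintegral_smul_measure, ENNReal.smul_def, smul_eq_mul, mul_comm]

theorem negPowerSum_lintegral_le (hκ : 0 ≤ κ) {f g h : E → ℝ≥0∞} (hh : AEMeasurable h μ)
    (hfgh : ∀ x y, negPowerSum (finrank ℝ E + κ) (f x) (g y) ≤ h (x + y)) :
    negPowerSum κ (∫⁻ x, f x ∂μ) (∫⁻ x, g x ∂μ) ≤ ∫⁻ x, h x ∂μ := by
  obtain ⟨e, c, hc, lintegral_eq⟩ := exists_lintegral_eq_mul_lintegral_pi μ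
  obtain ⟨f', hf', hf'_le, hf'_eq⟩ := exists_measurable_le_lintegral_eq μ f
  obtain ⟨g', hg', hg'_le, hg'_eq⟩ := exists_measurable_le_lintegral_eq μ g
  obtain ⟨h', hh', hh'_le, hh'_eq⟩ := exists_measurable_ge_lintegral_eq hh
  have he : Measurable e := e.continuous.measurable
  rw [hf'_eq, hg'_eq, ← hh'_eq, lintegral_eq f' hf', lintegral_eq g' hg', lintegral_eq h' hh',
    negPowerSum_mul_right hκ _ _ hc]
  gcongr
  refine negPowerSum_lintegral_le_pi _ hκ (hf'.comp he) (hg'.comp he) (hh'.comp he) fun x y => ?_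
  calc negPowerSum (finrank ℝ E + κ) (f' (e x)) (g' (e y))
      ≤ negPowerSum (finrank ℝ E + κ) (f (e x)) (g (e y)) :=
        negPowerSum_mono (by positivity) (hf'_le _) (hg'_le _)
    _ ≤ h (e x + e y) := hfgh _ _
    _ ≤ h' (e (x + y)) := by rw [map_add]; exact hh'_le _

end FiniteDimensional

end BorellBrascampLieb

theorem weighted_rpow_mul_rpow_add_le {θ C D x y u v : ℝ} (hθ₀ : 0 ≤ θ) (hθ₁ : θ ≤ 1) (hC : 0 < C)
    (hD : 0 < D) (hx : 0 < x) (hy : 0 < y) (hu : 0 < u) (hv : 0 < v) :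
    C * (x ^ θ * u ^ (1 - θ)) + D * (y ^ θ * v ^ (1 - θ)) ≤
      (C * x + D * y) ^ θ * (C * u + D * v) ^ (1 - θ) := by
  have weight : ∀ {w a b : ℝ}, 0 < w → 0 < a → 0 < b →
      (w * a) ^ θ * (w * b) ^ (1 - θ) = w * (a ^ θ * b ^ (1 - θ)) := fun {w a b} hw ha hb => by
    rw [Real.mul_rpow hw.le ha.le, Real.mul_rpow hw.le hb.le, mul_mul_mul_comm, ← Real.rpow_add hw,
      add_sub_cancel, Real.rpow_one]
  rw [← weight hC hx hu, ← weight hD hy hv]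
  exact rpow_mul_rpow_add_le hθ₀ hθ₁ (by positivity) (by positivity) (by positivity)
    (by positivity)

section sMean

variable {C D a b : ℝ}

theorem sMean_zero_left (s : EReal) (C D b : ℝ) : sMean s C D 0 b = 0 := by
  simp only [sMean, zero_mul, lt_irrefl, if_false]

theorem sMean_zero_right (s : EReal) (C D a : ℝ) : sMean s C D a 0 = 0 := by
  simp only [sMean, mul_zero, lt_irrefl, if_false]

theorem sMean_zero (C D : ℝ) (ha : 0 < a) (hb : 0 < b) : sMean 0 C D a b = a ^ C * b ^ D := by
  rw [sMean, if_pos (mul_pos ha hb), if_neg EReal.zero_ne_bot, if_neg EReal.zero_ne_top, if_pos rfl]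

theorem sMean_coe {s : ℝ} (hs : s ≠ 0) (C D : ℝ) (ha : 0 < a) (hb : 0 < b) :
    sMean s C D a b = (C * a ^ s + D * b ^ s) ^ (1 / s) := by
  rw [sMean, if_pos (mul_pos ha hb), if_neg (EReal.coe_ne_bot s), if_neg (EReal.coe_ne_top s),
    if_neg (EReal.coe_ne_zero.2 hs), EReal.toReal_coe]

theorem sMean_coe_pos (s : ℝ) (hC : 0 < C) (hD : 0 < D) (ha : 0 < a) (hb : 0 < b) :
    0 < sMean s C D a b := by
  rcases eq_or_ne s 0 with rfl | hs
  · rw [EReal.coe_zero, sMean_zero C D ha hb]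
    positivity
  · rw [sMean_coe hs C D ha hb]
    positivity

theorem sMean_neg_inv {m : ℝ} (hm : m ≠ 0) (C D : ℝ) (ha : 0 < a) (hb : 0 < b) :
    sMean (-m⁻¹ : ℝ) C D a b = (C * a ^ (-m⁻¹) + D * b ^ (-m⁻¹)) ^ (-m) := by
  rw [sMean_coe (neg_ne_zero.2 (inv_ne_zero hm)) C D ha hb, one_div, inv_neg, inv_inv]

theorem negPowerSum_ofReal_inv_rpow_mul {κ : ℝ} (hκ : 0 < κ) (hC : 0 < C) (hD : 0 < D)
    (ha : 0 < a) (hb : 0 < b) :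
    negPowerSum κ (ENNReal.ofReal ((C ^ κ)⁻¹ * a)) (ENNReal.ofReal ((D ^ κ)⁻¹ * b)) =
      ENNReal.ofReal (sMean (-κ⁻¹ : ℝ) C D a b) := by
  have weight : ∀ {w x : ℝ}, 0 < w → 0 < x → ((w ^ κ)⁻¹ * x) ^ (-κ⁻¹) = w * x ^ (-κ⁻¹) :=
    fun hw hx => by
      rw [Real.mul_rpow (by positivity) hx.le, ← Real.rpow_neg hw.le, ← Real.rpow_mul hw.le,
        neg_mul_neg, mul_inv_cancel₀ hκ.ne', Real.rpow_one]
  rw [negPowerSum_ofReal hκ (by positivity) (by positivity), weight hC ha, weight hD hb,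
    sMean_neg_inv hκ.ne' C D ha hb]

variable {m s F G : ℝ}

theorem sMean_mul_sMean_le_of_neg (hm : 0 < m) (hs : s < 0) (hms : 0 < 1 + m * s) (hC : 0 < C)
    (hD : 0 < D) (hF : 0 < F) (hG : 0 < G) (ha : 0 < a) (hb : 0 < b) :
    sMean (s / (1 + m * s) : ℝ) C D F G * sMean (-m⁻¹ : ℝ) C D a b ≤
      sMean s C D (F * a) (G * b) := by
  set θ := 1 + m * s with hθ
  have hθ₁ : θ ≤ 1 := by linarith [mul_neg_of_pos_of_neg hm hs]
  have term : ∀ {A x : ℝ}, 0 < A → 0 < x →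
      (A ^ (s / θ)) ^ θ * (x ^ (-m⁻¹)) ^ (1 - θ) = (A * x) ^ s := fun {A x} hA hx => by
    rw [Real.mul_rpow hA.le hx.le, ← Real.rpow_mul hA.le, ← Real.rpow_mul hx.le,
      div_mul_cancel₀ _ hms.ne', show -m⁻¹ * (1 - θ) = s by rw [hθ]; field_simp; ring]
  have holder := weighted_rpow_mul_rpow_add_le hms.le hθ₁ hC hD (Real.rpow_pos_of_pos hF (s / θ))
    (Real.rpow_pos_of_pos hG (s / θ)) (Real.rpow_pos_of_pos ha (-m⁻¹))
    (Real.rpow_pos_of_pos hb (-m⁻¹))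
  rw [term hF ha, term hG hb] at holder
  rw [sMean_coe (div_ne_zero hs.ne hms.ne') C D hF hG, sMean_neg_inv hm.ne' C D ha hb,
    sMean_coe hs.ne C D (mul_pos hF ha) (mul_pos hG hb)]
  set X := C * F ^ (s / θ) + D * G ^ (s / θ)
  set Y := C * a ^ (-m⁻¹) + D * b ^ (-m⁻¹)
  have hX : 0 < X := by positivity
  have hY : 0 < Y := by positivity
  calc X ^ (1 / (s / θ)) * Y ^ (-m) = (X ^ θ * Y ^ (1 - θ)) ^ (1 / s) := by
        rw [Real.mul_rpow (by positivity) (by positivity), ← Real.rpow_mul hX.le,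
          ← Real.rpow_mul hY.le, one_div_div, mul_one_div,
          show (1 - θ) * (1 / s) = -m by rw [hθ]; field_simp [hs.ne]; ring]
    _ ≤ (C * (F * a) ^ s + D * (G * b) ^ s) ^ (1 / s) :=
        Real.rpow_le_rpow_of_nonpos (by positivity) holder (one_div_nonpos.2 hs.le)

theorem sMean_mul_sMean_le_of_pos (hm : 0 < m) (hs : 0 < s) (hC : 0 < C) (hD : 0 < D) (hF : 0 < F)
    (hG : 0 < G) (ha : 0 < a) (hb : 0 < b) :
    sMean (s / (1 + m * s) : ℝ) C D F G * sMean (-m⁻¹ : ℝ) C D a b ≤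
      sMean s C D (F * a) (G * b) := by
  set γ := s / (1 + m * s) with hγ
  set θ := (1 + m * s)⁻¹ with hθ
  have hγ₀ : 0 < γ := by positivity
  have hθ₁ : θ ≤ 1 := inv_le_one_of_one_le₀ (by linarith [mul_pos hm hs])
  have term : ∀ {A x : ℝ}, 0 < A → 0 < x →
      ((A * x) ^ s) ^ θ * (x ^ (-m⁻¹)) ^ (1 - θ) = A ^ γ := fun {A x} hA hx => by
    rw [← Real.rpow_mul (by positivity), ← div_eq_mul_inv, ← hγ, Real.mul_rpow hA.le hx.le,
      ← Real.rpow_mul hx.le, mul_assoc, ← Real.rpow_add hx,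
      show γ + -m⁻¹ * (1 - θ) = 0 by rw [hγ, hθ]; field_simp; ring, Real.rpow_zero, mul_one]
  have holder := weighted_rpow_mul_rpow_add_le (by positivity : 0 ≤ θ) hθ₁ hC hD
    (Real.rpow_pos_of_pos (mul_pos hF ha) s) (Real.rpow_pos_of_pos (mul_pos hG hb) s)
    (Real.rpow_pos_of_pos ha (-m⁻¹)) (Real.rpow_pos_of_pos hb (-m⁻¹))
  rw [term hF ha, term hG hb] at holder
  rw [sMean_coe hγ₀.ne' C D hF hG, sMean_neg_inv hm.ne' C D ha hb,
    sMean_coe hs.ne' C D (mul_pos hF ha) (mul_pos hG hb)]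
  set Z := C * (F * a) ^ s + D * (G * b) ^ s
  set Y := C * a ^ (-m⁻¹) + D * b ^ (-m⁻¹)
  have hZ : 0 < Z := by positivity
  have hY : 0 < Y := by positivity
  rw [Real.rpow_neg hY.le, ← div_eq_mul_inv, div_le_iff₀ (by positivity)]
  calc (C * F ^ γ + D * G ^ γ) ^ (1 / γ) ≤ (Z ^ θ * Y ^ (1 - θ)) ^ (1 / γ) :=
        Real.rpow_le_rpow (by positivity) holder (by positivity)
    _ = Z ^ (1 / s) * Y ^ m := by
        rw [Real.mul_rpow (by positivity) (by positivity), ← Real.rpow_mul hZ.le,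
          ← Real.rpow_mul hY.le, show θ * (1 / γ) = 1 / s by rw [hγ, hθ]; field_simp,
          show (1 - θ) * (1 / γ) = m by rw [hγ, hθ]; field_simp; ring]

theorem sMean_zero_mul_sMean_le (hm : 0 < m) (hC : 0 < C) (hD : 0 < D) (hCD : C + D = 1)
    (hF : 0 < F) (hG : 0 < G) (ha : 0 < a) (hb : 0 < b) :
    sMean 0 C D F G * sMean (-m⁻¹ : ℝ) C D a b ≤ sMean 0 C D (F * a) (G * b) := by
  have amgm := Real.geom_mean_le_arith_mean2_weighted hC.le hD.le
    (Real.rpow_nonneg ha.le (-m⁻¹)) (Real.rpow_nonneg hb.le (-m⁻¹)) hCD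
  have sMean_le : sMean (-m⁻¹ : ℝ) C D a b ≤ a ^ C * b ^ D := by
    rw [sMean_neg_inv hm.ne' C D ha hb]
    calc (C * a ^ (-m⁻¹) + D * b ^ (-m⁻¹)) ^ (-m)
        ≤ ((a ^ (-m⁻¹)) ^ C * (b ^ (-m⁻¹)) ^ D) ^ (-m) :=
          Real.rpow_le_rpow_of_nonpos (by positivity) amgm (neg_nonpos.2 hm.le)
      _ = a ^ C * b ^ D := by
          rw [Real.mul_rpow (by positivity) (by positivity)]
          simp only [← Real.rpow_mul ha.le, ← Real.rpow_mul hb.le]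
          congr 2 <;> field_simp
  rw [sMean_zero C D hF hG, sMean_zero C D (mul_pos hF ha) (mul_pos hG hb),
    Real.mul_rpow hF.le ha.le, Real.mul_rpow hG.le hb.le, mul_mul_mul_comm]
  gcongr

theorem sMean_mul_sMean_le (hm : 0 < m) (hms : 0 < 1 + m * s) (hC : 0 < C) (hD : 0 < D)
    (hCD : s = 0 → C + D = 1) (hF : 0 < F) (hG : 0 < G) (ha : 0 < a) (hb : 0 < b) :
    sMean (s / (1 + m * s) : ℝ) C D F G * sMean (-m⁻¹ : ℝ) C D a b ≤
      sMean s C D (F * a) (G * b) := by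
  rcases lt_trichotomy s 0 with hs | rfl | hs
  · exact sMean_mul_sMean_le_of_neg hm hs hms hC hD hF hG ha hb
  · simpa only [zero_div, EReal.coe_zero] using
      sMean_zero_mul_sMean_le hm hC hD (hCD rfl) hF hG ha hb
  · exact sMean_mul_sMean_le_of_pos hm hs hC hD hF hG ha hb

theorem sMean_neg_inv_rpow_mul_le (hm : 0 < m) (hs : s ≤ -m⁻¹) (hC : 0 < C) (hD : 0 < D)
    (ha : 0 < a) (hb : 0 < b) :
    sMean (-m⁻¹ : ℝ) C D (C ^ (m + 1 / s) * a) (D ^ (m + 1 / s) * b) ≤ sMean s C D a b := by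
  have hs₀ : s < 0 := hs.trans_lt (neg_neg_of_pos (inv_pos.2 hm))
  set θ := m⁻¹ / -s with hθ
  have hθ₀ : 0 ≤ θ := by have := neg_pos.2 hs₀; positivity
  have hθ₁ : θ ≤ 1 := (div_le_one (neg_pos.2 hs₀)).2 (le_neg.2 hs)
  have weight : ∀ {w x : ℝ}, 0 < w → 0 < x →
      w * (w ^ (m + 1 / s) * x) ^ (-m⁻¹) = (w * x ^ s) ^ θ := fun {w x} hw hx => by
    have w_exponent : 1 + (m + 1 / s) * -m⁻¹ = θ := by rw [hθ]; field_simp [hs₀.ne]; ring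
    have x_exponent : s * θ = -m⁻¹ := by rw [hθ]; field_simp [hs₀.ne]
    rw [Real.mul_rpow (by positivity) hx.le, Real.mul_rpow hw.le (by positivity),
      ← Real.rpow_mul hw.le, ← Real.rpow_mul hx.le, x_exponent, ← mul_assoc, ← w_exponent,
      Real.rpow_add hw, Real.rpow_one]
  rw [sMean_neg_inv hm.ne' C D (by positivity) (by positivity), weight hC ha, weight hD hb,
    sMean_coe hs₀.ne C D ha hb]
  calc ((C * a ^ s) ^ θ + (D * b ^ s) ^ θ) ^ (-m)
      ≤ ((C * a ^ s + D * b ^ s) ^ θ) ^ (-m) :=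
        Real.rpow_le_rpow_of_nonpos (by positivity)
          (Real.rpow_add_le_add_rpow (by positivity) (by positivity) hθ₀ hθ₁)
          (neg_nonpos.2 hm.le)
    _ = (C * a ^ s + D * b ^ s) ^ (1 / s) := by
        rw [← Real.rpow_mul (by positivity), show θ * -m = 1 / s by rw [hθ]; field_simp [hs₀.ne]]

end sMean

section FiniteDimensional

variable {E : Type*} [NormedAddCommGroup E] [NormedSpace ℝ E] [FiniteDimensional ℝ E]
  [MeasurableSpace E] [BorelSpace E] {μ : Measure E} [μ.IsAddHaarMeasure]

theorem lintegral_ofReal_inv_pow_mul_comp_inv_smul {u : E → ℝ} (hu₀ : ∀ x, 0 ≤ u x)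
    (hu : Integrable u μ) {c : ℝ} (hc : 0 < c) :
    ∫⁻ x, ENNReal.ofReal ((c ^ finrank ℝ E)⁻¹ * u (c⁻¹ • x)) ∂μ = ENNReal.ofReal (∫ x, u x ∂μ) := by
  rw [← ofReal_integral_eq_lintegral_ofReal ((hu.comp_smul (inv_ne_zero hc.ne')).const_mul _)
    (.of_forall fun x => mul_nonneg (by positivity) (hu₀ _)), integral_const_mul,
    Measure.integral_comp_inv_smul_of_nonneg μ u hc.le, smul_eq_mul,
    inv_mul_cancel_left₀ (by positivity)]

variable [Nontrivial E] {f g h : E → ℝ} {C D s : ℝ}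

theorem min_integral_le_of_sMean_le (hf₀ : ∀ x, 0 ≤ f x) (hg₀ : ∀ x, 0 ≤ g x)
    (hh₀ : ∀ x, 0 ≤ h x) (hf : Integrable f μ) (hg : Integrable g μ) (hh : Integrable h μ)
    (hC : 0 < C) (hD : 0 < D)
    (hfgh : ∀ x ∈ support f, ∀ y ∈ support g,
      sMean (-(finrank ℝ E : ℝ)⁻¹ : ℝ) C D (f x) (g y) ≤ h (C • x + D • y)) :
    min (∫ x, f x ∂μ) (∫ x, g x ∂μ) ≤ ∫ x, h x ∂μ := by
  have hn : 0 < (finrank ℝ E : ℝ) := Nat.cast_pos.2 finrank_pos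
  have rescaled : ∀ x y : E,
      negPowerSum (finrank ℝ E + 0) (ENNReal.ofReal ((C ^ finrank ℝ E)⁻¹ * f (C⁻¹ • x)))
        (ENNReal.ofReal ((D ^ finrank ℝ E)⁻¹ * g (D⁻¹ • y))) ≤ ENNReal.ofReal (h (x + y)) := by
    intro x y
    rw [add_zero]
    rcases (hf₀ (C⁻¹ • x)).eq_or_lt with hx | hx
    · simp only [← hx, mul_zero, ENNReal.ofReal_zero, negPowerSum_zero_left hn.le, zero_le]
    rcases (hg₀ (D⁻¹ • y)).eq_or_lt with hy | hy
    · simp only [← hy, mul_zero, ENNReal.ofReal_zero, negPowerSum_zero_right hn.le, zero_le]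
    rw [← Real.rpow_natCast, ← Real.rpow_natCast, negPowerSum_ofReal_inv_rpow_mul hn hC hD hx hy]
    have := hfgh _ hx.ne' _ hy.ne'
    rw [smul_inv_smul₀ hC.ne', smul_inv_smul₀ hD.ne'] at this
    exact ENNReal.ofReal_le_ofReal this
  have bbl := negPowerSum_lintegral_le μ le_rfl hh.aemeasurable.ennreal_ofReal rescaled
  rwa [negPowerSum_zero, lintegral_ofReal_inv_pow_mul_comp_inv_smul hf₀ hf hC,
    lintegral_ofReal_inv_pow_mul_comp_inv_smul hg₀ hg hD,
    ← ofReal_integral_eq_lintegral_ofReal hh (.of_forall hh₀), ← ENNReal.ofReal_min,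
    ENNReal.ofReal_le_ofReal_iff (integral_nonneg hh₀)] at bbl

theorem sMean_integral_le_of_lt (hf₀ : ∀ x, 0 ≤ f x) (hg₀ : ∀ x, 0 ≤ g x) (hh₀ : ∀ x, 0 ≤ h x)
    (hf : Integrable f μ) (hg : Integrable g μ) (hh : Integrable h μ) (hC : 0 < C) (hD : 0 < D)
    (hs : 0 < 1 + finrank ℝ E * s) (hCD : s = 0 → C + D = 1)
    (hfgh : ∀ x ∈ support f, ∀ y ∈ support g, sMean s C D (f x) (g y) ≤ h (C • x + D • y)) :
    sMean (s / (1 + finrank ℝ E * s) : ℝ) C D (∫ x, f x ∂μ) (∫ x, g x ∂μ) ≤ ∫ x, h x ∂μ := by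
  have hn : 0 < (finrank ℝ E : ℝ) := Nat.cast_pos.2 finrank_pos
  rcases (integral_nonneg hf₀ : 0 ≤ ∫ x, f x ∂μ).eq_or_lt with hF | hF
  · rw [← hF, sMean_zero_left]
    exact integral_nonneg hh₀
  rcases (integral_nonneg hg₀ : 0 ≤ ∫ x, g x ∂μ).eq_or_lt with hG | hG
  · rw [← hG, sMean_zero_right]
    exact integral_nonneg hh₀
  set F := ∫ x, f x ∂μ with hF_def
  set G := ∫ x, g x ∂μ with hG_def
  set K := sMean (s / (1 + finrank ℝ E * s) : ℝ) C D F G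
  have hK : 0 < K := sMean_coe_pos _ hC hD hF hG
  have normalized : min (∫ x, f x / F ∂μ) (∫ x, g x / G ∂μ) ≤ ∫ x, h x / K ∂μ := by
    refine min_integral_le_of_sMean_le (fun x => div_nonneg (hf₀ x) hF.le)
      (fun x => div_nonneg (hg₀ x) hG.le) (fun x => div_nonneg (hh₀ x) hK.le) (hf.div_const F)
      (hg.div_const G) (hh.div_const K) hC hD fun x hx y hy => ?_
    have hfx : f x ≠ 0 := (div_ne_zero_iff.1 hx).1
    have hgy : g y ≠ 0 := (div_ne_zero_iff.1 hy).1
    have holder := sMean_mul_sMean_le hn hs hC hD hCD hF hG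
      (div_pos ((hf₀ x).lt_of_ne' hfx) hF) (div_pos ((hg₀ y).lt_of_ne' hgy) hG)
    rw [mul_div_cancel₀ _ hF.ne', mul_div_cancel₀ _ hG.ne'] at holder
    rw [le_div_iff₀' hK]
    exact holder.trans (hfgh x hfx y hgy)
  rwa [integral_div, integral_div, integral_div, ← hF_def, ← hG_def, div_self hF.ne',
    div_self hG.ne', min_self, one_le_div hK] at normalized

theorem sMean_bblExponent_integral_le (hf₀ : ∀ x, 0 ≤ f x) (hg₀ : ∀ x, 0 ≤ g x)
    (hh₀ : ∀ x, 0 ≤ h x) (hf : Integrable f μ) (hg : Integrable g μ) (hh : Integrable h μ)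
    (hC : 0 < C) (hD : 0 < D) (hs : -(finrank ℝ E : ℝ)⁻¹ ≤ s) (hCD : s = 0 → C + D = 1)
    (hfgh : ∀ x ∈ support f, ∀ y ∈ support g, sMean s C D (f x) (g y) ≤ h (C • x + D • y)) :
    sMean (bblExponent (finrank ℝ E) s) C D (∫ x, f x ∂μ) (∫ x, g x ∂μ) ≤ ∫ x, h x ∂μ := by
  have hn : 0 < (finrank ℝ E : ℝ) := Nat.cast_pos.2 finrank_pos
  rcases hs.eq_or_lt with rfl | hs
  · rw [bblExponent, if_pos (by rw [mul_neg, mul_inv_cancel₀ hn.ne', add_neg_cancel])]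
    refine le_trans ?_ (min_integral_le_of_sMean_le hf₀ hg₀ hh₀ hf hg hh hC hD hfgh)
    have hF : 0 ≤ ∫ x, f x ∂μ := integral_nonneg hf₀
    have hG : 0 ≤ ∫ x, g x ∂μ := integral_nonneg hg₀
    rw [sMean, if_pos rfl]
    split_ifs
    exacts [le_rfl, le_min hF hG]
  · have hns : 0 < 1 + finrank ℝ E * s := by
      have := mul_lt_mul_of_pos_left hs hn
      rw [mul_neg, mul_inv_cancel₀ hn.ne'] at this
      linarith
    rw [bblExponent, if_neg hns.ne']
    exact sMean_integral_le_of_lt hf₀ hg₀ hh₀ hf hg hh hC hD hns hCD hfgh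

theorem min_rpow_mul_integral_le (hf₀ : ∀ x, 0 ≤ f x) (hg₀ : ∀ x, 0 ≤ g x) (hh₀ : ∀ x, 0 ≤ h x)
    (hf : Integrable f μ) (hg : Integrable g μ) (hh : Integrable h μ) (hC : 0 < C) (hD : 0 < D)
    (hs : s ≤ -(finrank ℝ E : ℝ)⁻¹)
    (hfgh : ∀ x ∈ support f, ∀ y ∈ support g, sMean s C D (f x) (g y) ≤ h (C • x + D • y)) :
    min (C ^ (finrank ℝ E + 1 / s) * ∫ x, f x ∂μ) (D ^ (finrank ℝ E + 1 / s) * ∫ x, g x ∂μ) ≤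
      ∫ x, h x ∂μ := by
  have hn : 0 < (finrank ℝ E : ℝ) := Nat.cast_pos.2 finrank_pos
  rw [← integral_const_mul, ← integral_const_mul]
  refine min_integral_le_of_sMean_le (fun x => mul_nonneg (by positivity) (hf₀ x))
    (fun x => mul_nonneg (by positivity) (hg₀ x)) hh₀ (hf.const_mul _) (hg.const_mul _) hh hC hD
    fun x hx y hy => ?_
  have hfx : f x ≠ 0 := right_ne_zero_of_mul hx
  have hgy : g y ≠ 0 := right_ne_zero_of_mul hy
  exact (sMean_neg_inv_rpow_mul_le hn hs hC hD ((hf₀ x).lt_of_ne' hfx)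
    ((hg₀ y).lt_of_ne' hgy)).trans (hfgh x hfx y hgy)

end FiniteDimensional

section LpCoefficients

variable {p lam t : ℝ}

theorem lpCoeffC_pos (p : ℝ) (ht : t < 1) (hlam : lam < 1) : 0 < lpCoeffC p lam t :=
  mul_pos (Real.rpow_pos_of_pos (sub_pos.2 ht) _) (Real.rpow_pos_of_pos (sub_pos.2 hlam) _)

theorem lpCoeffD_pos (p : ℝ) (ht : 0 < t) (hlam : 0 < lam) : 0 < lpCoeffD p lam t :=
  mul_pos (Real.rpow_pos_of_pos ht _) (Real.rpow_pos_of_pos hlam _)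

theorem lpCoeffC_self (p : ℝ) (ht : t < 1) : lpCoeffC p t t = 1 - t := by
  rw [lpCoeffC, ← Real.rpow_add (sub_pos.2 ht), add_sub_cancel, Real.rpow_one]

theorem lpCoeffD_self (p : ℝ) (ht : 0 < t) : lpCoeffD p t t = t := by
  rw [lpCoeffD, ← Real.rpow_add ht, add_sub_cancel, Real.rpow_one]

theorem lpCoeff_eq_zero_or_exists_mem_Ioo (p t : ℝ) (hlam : lam ∈ Icc (0 : ℝ) 1) :
    lpCoeffC p lam t = 0 ∨ lpCoeffD p lam t = 0 ∨ ∃ lam' ∈ Ioo (0 : ℝ) 1,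
      lpCoeffC p lam' t = lpCoeffC p lam t ∧ lpCoeffD p lam' t = lpCoeffD p lam t := by
  rcases eq_or_ne p 1 with rfl | hp
  · refine .inr (.inr ⟨1 / 2, by norm_num, ?_⟩)
    simp only [lpCoeffC, lpCoeffD, div_one, sub_self, Real.rpow_zero, and_self]
  have hq : 1 - 1 / p ≠ 0 := by
    rw [sub_ne_zero, one_div]
    exact fun h => hp (inv_eq_one.1 h.symm)
  rcases hlam.1.eq_or_lt with rfl | h₀
  · exact .inr (.inl (by rw [lpCoeffD, Real.zero_rpow hq, mul_zero]))
  rcases hlam.2.eq_or_lt with rfl | h₁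
  · exact .inl (by rw [lpCoeffC, sub_self, Real.zero_rpow hq, mul_zero])
  · exact .inr (.inr ⟨lam, ⟨h₀, h₁⟩, rfl, rfl⟩)

theorem exists_lpCoeff_mul_rpow_add_eq (hp : 0 < p) (ht₀ : 0 < t) (ht₁ : t < 1) {F G : ℝ}
    (hF : 0 < F) (hG : 0 < G) (r : ℝ) :
    ∃ lam ∈ Ioo (0 : ℝ) 1, lpCoeffC p lam t * F ^ r + lpCoeffD p lam t * G ^ r =
      ((1 - t) * F ^ (p * r) + t * G ^ (p * r)) ^ (1 / p) := by
  have ht₁' : 0 < 1 - t := sub_pos.2 ht₁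
  set X := (1 - t) * F ^ (p * r)
  set Y := t * G ^ (p * r)
  have hX : 0 < X := by positivity
  have term : ∀ {w A : ℝ}, 0 < w → 0 < A →
      w ^ (1 / p) * (w * A ^ (p * r) / (X + Y)) ^ (1 - 1 / p) * A ^ r =
        w * A ^ (p * r) * (X + Y) ^ (1 / p - 1) := fun {w A} hw hA => by
    set Z := w * A ^ (p * r)
    have hZ : 0 < Z := by positivity
    have split : w ^ (1 / p) * A ^ r = Z ^ (1 / p) := by
      rw [Real.mul_rpow hw.le (by positivity), ← Real.rpow_mul hA.le, mul_right_comm,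
        mul_one_div_cancel hp.ne', one_mul]
    rw [mul_right_comm, split, Real.div_rpow hZ.le (by positivity), ← mul_div_assoc,
      ← Real.rpow_add hZ, add_sub_cancel, Real.rpow_one, div_eq_mul_inv,
      ← Real.rpow_neg (by positivity), neg_sub]
  -- Equality case of Hölder: `(1 - lam : lam) = (X : Y)`.
  refine ⟨Y / (X + Y), ⟨by positivity, (div_lt_one (by positivity)).2 (by linarith)⟩, ?_⟩
  rw [lpCoeffC, lpCoeffD, one_sub_div (by positivity), add_sub_cancel_right, term ht₁' hF,
    term ht₀ hG, ← add_mul, ← Real.rpow_one_add' (by positivity) (by simp [hp.ne']),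
    add_sub_cancel]

theorem exists_sMean_lpCoeff_eq (hp : 0 < p) (ht₀ : 0 < t) (ht₁ : t < 1) {F G : ℝ} (hF : 0 ≤ F)
    (hG : 0 ≤ G) (r : EReal) :
    ∃ lam ∈ Ioo (0 : ℝ) 1, (r = 0 → lpCoeffC p lam t + lpCoeffD p lam t = 1) ∧
      sMean r (lpCoeffC p lam t) (lpCoeffD p lam t) F G = sMean (p * r) (1 - t) t F G := by
  have of_lam_eq_t : sMean r (1 - t) t F G = sMean (p * r) (1 - t) t F G →
      ∃ lam ∈ Ioo (0 : ℝ) 1, (r = 0 → lpCoeffC p lam t + lpCoeffD p lam t = 1) ∧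
        sMean r (lpCoeffC p lam t) (lpCoeffD p lam t) F G = sMean (p * r) (1 - t) t F G := fun h =>
    ⟨t, ⟨ht₀, ht₁⟩, fun _ => by rw [lpCoeffC_self p ht₁, lpCoeffD_self p ht₀, sub_add_cancel],
      by rwa [lpCoeffC_self p ht₁, lpCoeffD_self p ht₀]⟩
  rcases hF.eq_or_lt with rfl | hF
  · exact of_lam_eq_t (by simp only [sMean_zero_left])
  rcases hG.eq_or_lt with rfl | hG
  · exact of_lam_eq_t (by simp only [sMean_zero_right])
  induction r with
  | bot => exact of_lam_eq_t (by rw [EReal.coe_mul_bot_of_pos hp])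
  | top => exact of_lam_eq_t (by rw [EReal.coe_mul_top_of_pos hp])
  | coe r =>
    rcases eq_or_ne r 0 with rfl | hr
    · exact of_lam_eq_t (by rw [EReal.coe_zero, mul_zero])
    obtain ⟨lam, hlam, h⟩ := exists_lpCoeff_mul_rpow_add_eq hp ht₀ ht₁ hF hG r
    have hpos : 0 < (1 - t) * F ^ (p * r) + t * G ^ (p * r) := by
      have := sub_pos.2 ht₁
      positivity
    refine ⟨lam, hlam, fun hr₀ => absurd (EReal.coe_eq_zero.1 hr₀) hr, ?_⟩
    rw [← EReal.coe_mul, sMean_coe hr _ _ hF hG, sMean_coe (mul_ne_zero hp.ne' hr) _ _ hF hG, h,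
      ← Real.rpow_mul hpos.le, one_div_mul_one_div]

end LpCoefficients

theorem one_div_div_one_add_mul {m s : ℝ} (hs : s ≠ 0) : 1 / (s / (1 + m * s)) = m + 1 / s := by
  rw [one_div_div, add_div, mul_div_cancel_right₀ _ hs, add_comm]

theorem add_one_div_pos_of_lt_neg_inv {m s : ℝ} (hm : 0 < m) (hs : s < -m⁻¹) : 0 < m + 1 / s := by
  have hs₀ : s < 0 := hs.trans (neg_neg_of_pos (inv_pos.2 hm))
  have := (one_div_lt_one_div_of_neg (neg_neg_of_pos (inv_pos.2 hm)) hs₀).2 hs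
  rw [one_div, inv_neg, inv_inv] at this
  linarith

/-- For `p < 1` the coefficient `D` vanishes at `lam = 0`, and `C` at `lam = 1`, by the convention
`0 ^ x = 0` for `x < 0`. -/
theorem theoremt_general {E : Type*} [NormedAddCommGroup E] [NormedSpace ℝ E]
    [FiniteDimensional ℝ E] [Nontrivial E] [MeasurableSpace E] [BorelSpace E] (μ : Measure E)
    [μ.IsAddHaarMeasure] {p s t : ℝ} (hp : 0 < p) (ht₀ : 0 < t) (ht₁ : t < 1) {f g h : E → ℝ}
    (hf₀ : ∀ x, 0 ≤ f x) (hg₀ : ∀ x, 0 ≤ g x) (hh₀ : ∀ x, 0 ≤ h x)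
    (hf : Integrable f μ) (hg : Integrable g μ) (hh : Integrable h μ)
    (hfgh : ∀ x ∈ support f, ∀ y ∈ support g, ∀ lam ∈ Ioo (0 : ℝ) 1,
      sMean s (lpCoeffC p lam t) (lpCoeffD p lam t) (f x) (g y) ≤
        h (lpCoeffC p lam t • x + lpCoeffD p lam t • y)) :
    (-(1 / (finrank ℝ E : ℝ)) ≤ s →
      sMean (p * bblExponent (finrank ℝ E) s) (1 - t) t (∫ x, f x ∂μ) (∫ x, g x ∂μ) ≤
        ∫ x, h x ∂μ) ∧
    (s < -(1 / (finrank ℝ E : ℝ)) → ∀ lam ∈ Icc (0 : ℝ) 1,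
      min (lpCoeffC p lam t ^ (1 / (s / (1 + finrank ℝ E * s))) * ∫ x, f x ∂μ)
        (lpCoeffD p lam t ^ (1 / (s / (1 + finrank ℝ E * s))) * ∫ x, g x ∂μ) ≤ ∫ x, h x ∂μ) := by
  have hn : 0 < (finrank ℝ E : ℝ) := Nat.cast_pos.2 finrank_pos
  rw [one_div]
  constructor
  · intro hs
    obtain ⟨lam, hlam, hsum, hmean⟩ := exists_sMean_lpCoeff_eq hp ht₀ ht₁
      (integral_nonneg hf₀ : 0 ≤ ∫ x, f x ∂μ) (integral_nonneg hg₀ : 0 ≤ ∫ x, g x ∂μ)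
      (bblExponent (finrank ℝ E) s)
    rw [← hmean]
    refine sMean_bblExponent_integral_le hf₀ hg₀ hh₀ hf hg hh (lpCoeffC_pos p ht₁ hlam.2)
      (lpCoeffD_pos p ht₀ hlam.1) hs (fun hs₀ => hsum (by simp [bblExponent, hs₀]))
      fun x hx y hy => hfgh x hx y hy lam hlam
  · intro hs lam hlam
    have hs₀ : s < 0 := hs.trans (neg_neg_of_pos (inv_pos.2 hn))
    have exponent_pos := add_one_div_pos_of_lt_neg_inv hn hs
    rw [one_div_div_one_add_mul hs₀.ne]
    rcases lpCoeff_eq_zero_or_exists_mem_Ioo p t hlam with hC | hD | ⟨lam', hlam', hC, hD⟩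
    · rw [hC, Real.zero_rpow exponent_pos.ne', zero_mul]
      exact (min_le_left _ _).trans (integral_nonneg hh₀)
    · rw [hD, Real.zero_rpow exponent_pos.ne', zero_mul]
      exact (min_le_right _ _).trans (integral_nonneg hh₀)
    · rw [← hC, ← hD]
      exact min_rpow_mul_integral_le hf₀ hg₀ hh₀ hf hg hh (lpCoeffC_pos p ht₁ hlam'.2)
        (lpCoeffD_pos p ht₀ hlam'.1) hs.le fun x hx y hy => hfgh x hx y hy lam' hlam'

theorem theoremt (n : ℕ) (hn : 0 < n) (p s t : ℝ) (hp : 1 ≤ p) (ht0 : 0 < t) (ht1 : t < 1)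
    (f g h : EuclideanSpace ℝ (Fin n) → ℝ)
    (hf0 : ∀ x, 0 ≤ f x) (hg0 : ∀ x, 0 ≤ g x) (hh0 : ∀ x, 0 ≤ h x)
    (hfb : BddAbove (Set.range f)) (hgb : BddAbove (Set.range g)) (hhb : BddAbove (Set.range h))
    (hfi : Integrable f volume) (hgi : Integrable g volume) (hhi : Integrable h volume)
    (hfgh : ∀ x ∈ Function.support f, ∀ y ∈ Function.support g, ∀ lam ∈ Set.Icc (0 : ℝ) 1,
      sMean (s : EReal) (lpCoeffC p lam t) (lpCoeffD p lam t) (f x) (g y) ≤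
        h (lpCoeffC p lam t • x + lpCoeffD p lam t • y)) :
    (-(1 / (n : ℝ)) ≤ s →
      sMean ((p : EReal) * bblExponent n s) (1 - t) t (∫ x, f x) (∫ x, g x) ≤ ∫ x, h x) ∧
    (s < -(1 / (n : ℝ)) →
      ∀ lam ∈ Set.Icc (0 : ℝ) 1,
        min (lpCoeffC p lam t ^ (1 / (s / (1 + (n : ℝ) * s))) * ∫ x, f x)
          (lpCoeffD p lam t ^ (1 / (s / (1 + (n : ℝ) * s))) * ∫ x, g x) ≤ ∫ x, h x) := by
  have : Nonempty (Fin n) := ⟨⟨0, hn⟩⟩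
  simpa only [finrank_euclideanSpace_fin] using
    theoremt_general volume (one_pos.trans_le hp) ht0 ht1 hf0 hg0 hh0 hfi hgi hhi
      fun x hx y hy lam hlam => hfgh x hx y hy lam (Ioo_subset_Icc_self hlam)
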